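/- Let $E$ and $F$ be Banach spaces over the same scalar field $\mathbf K=\mathbf R$ or $\mathbf C$, let $k\ge 1$ be an integer, and let $P:E\to F$ be a continuous $k$-homogeneous polynomial, i.e. $P(x)=A(x,\dots,x)$ for some continuous $k$-linear map $A:E^k\to F$. A series $\sum_n x_n$ in $E$ is weakly unconditionally Cauchy if $\sum_n|f(x_n)|<\infty$ for every $f\in E^*$; a series is unconditionally converging if each of its subseries converges in norm. $P$ is called unconditionally converging if $\sum_n P(x_n)$ is unconditionally converging whenever $\sum_n x_n$ is weakly unconditionally Cauchy. Then $P$ is unconditionally converging in each of the following cases: (a) $P$ is completely continuous at $0$: $\|P(x_n)\|\to 0$ for every weakly null sequence $(x_n)$ in $E$. (b) $P$ takes Rosenthal subsets of $E$ into relatively norm compact subsets of $F$, where $A\subset E$ is a Rosenthal set if every sequence in $A$ has a weakly Cauchy subsequence. (c) The restriction of $P$ to each Dunford--Pettis subset $A$ of $E$ is continuous from the inherited weak topology on $A$ to the norm topology of $F$, where $A\subset E$ is a Dunford--Pettis set if $\lim_n\sup_{x\in A}|f_n(x)|=0$ for every weakly null sequence $(f_n)$ in $E^*$. (d) $P$ is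 weakly compact: it takes bounded subsets of $E$ into relatively weakly compact subsets of $F$. -/

import Mathlib

open Filter Topology

namespace UncondPoly

section

variable (𝕜 : Type*) [RCLike 𝕜]
variable {E : Type*} [NormedAddCommGroup E] [NormedSpace 𝕜 E]
variable {F : Type*} [NormedAddCommGroup F] [NormedSpace 𝕜 F]

/-- `P : E → F` is a continuous `k`-homogeneous polynomial: the restriction to the diagonal of a
continuous `k`-linear map. -/
def IsHomogeneousPolynomial (k : ℕ) (P : E → F) : Prop :=
  ∃ A : ContinuousMultilinearMap 𝕜 (fun _ : Fin k => E) F, ∀ x : E, P x = A (fun _ => x)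

/-- The series `∑ x n` is weakly unconditionally Cauchy: `∑ |f (x n)| < ∞` for every `f` in the
dual space. -/
def IsWUCSeries (x : ℕ → E) : Prop :=
  ∀ f : StrongDual 𝕜 E, Summable fun n => ‖f (x n)‖

/-- The series `∑ x n` is unconditionally converging: every subseries converges in norm
(as the limit of its partial sums). -/
def IsUCSeries {E : Type*} [NormedAddCommGroup E] (x : ℕ → E) : Prop :=
  ∀ φ : ℕ → ℕ, StrictMono φ →
    ∃ s : E, Tendsto (fun N => ∑ i ∈ Finset.range N, x (φ i)) atTop (𝓝 s)

/-- `P` takes weakly unconditionally Cauchy series into unconditionally converging series. -/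
def IsUnconditionallyConverging (P : E → F) : Prop :=
  ∀ x : ℕ → E, IsWUCSeries 𝕜 x → IsUCSeries fun n => P (x n)

/-- The sequence `x` converges to `0` in the weak topology of `E`. -/
def IsWeaklyNull (x : ℕ → E) : Prop :=
  Tendsto (fun n => toWeakSpace 𝕜 E (x n)) atTop (𝓝 0)

/-- The sequence `x` is weakly Cauchy. -/
def IsWeaklyCauchy (x : ℕ → E) : Prop :=
  ∀ f : StrongDual 𝕜 E, CauchySeq fun n => f (x n)

/-- `P` takes weakly null sequences into norm null sequences. -/
def IsCompletelyContinuousAtZero (P : E → F) : Prop :=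
  ∀ x : ℕ → E, IsWeaklyNull 𝕜 x → Tendsto (fun n => P (x n)) atTop (𝓝 0)

/-- Every sequence in `A` has a weakly Cauchy subsequence. -/
def IsRosenthalSet (A : Set E) : Prop :=
  ∀ x : ℕ → E, (∀ n, x n ∈ A) →
    ∃ φ : ℕ → ℕ, StrictMono φ ∧ IsWeaklyCauchy 𝕜 fun n => x (φ n)

/-- `P` takes Rosenthal sets into relatively (norm) compact sets. -/
def MapsRosenthalToRelativelyCompact (P : E → F) : Prop :=
  ∀ A : Set E, IsRosenthalSet 𝕜 A → IsCompact (closure (P '' A))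

/-- `A` is a Dunford-Pettis set: `sup_{x ∈ A} |f n x| → 0` for every sequence `f` in the dual
space that is null for the weak topology of the dual Banach space. The supremum is taken in
`[0, ∞]`. -/
def IsDunfordPettisSet (A : Set E) : Prop :=
  ∀ f : ℕ → StrongDual 𝕜 E, IsWeaklyNull 𝕜 f →
    Tendsto (fun n => ⨆ x ∈ A, ‖f n x‖ₑ) atTop (𝓝 0)

/-- The restriction of `P` to each Dunford-Pettis set, endowed with the inherited weak topology,
is continuous into `F` with its norm topology. -/
def IsWeaklyContinuousOnDunfordPettisSets (P : E → F) : Prop :=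
  ∀ A : Set E, IsDunfordPettisSet 𝕜 A →
    ContinuousOn (fun y : WeakSpace 𝕜 E => P ((toWeakSpace 𝕜 E).symm y))
      (toWeakSpace 𝕜 E '' A)

/-- `P` takes bounded sets into relatively weakly compact sets. -/
def IsWeaklyCompactMap (P : E → F) : Prop :=
  ∀ A : Set E, Bornology.IsBounded A → IsCompact (closure (toWeakSpace 𝕜 F '' (P '' A)))

end

end UncondPoly

namespace UncondPoly

/-- Interpolation at the nodes `i / k` recovers the linear coefficient of a polynomial. -/
lemma exists_linearCoeff_weights (k : ℕ) (hk : 1 ≤ k) :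
    ∃ l : ℕ → ℝ, ∀ r ≤ k,
      ∑ i ∈ Finset.range (k + 1), l i * ((i : ℝ) / k) ^ r = if r = 1 then 1 else 0 := by
  have hk0 : (k : ℝ) ≠ 0 := by positivity
  refine ⟨fun i => (Lagrange.basis (Finset.range (k + 1)) (fun i : ℕ => (i : ℝ) / k) i).coeff 1,
    fun r hr => ?_⟩
  have hinj : Set.InjOn (fun i : ℕ => (i : ℝ) / k) (Finset.range (k + 1)) := by
    intro a _ b _ hab
    simpa [div_left_inj' hk0] using hab
  have h := Lagrange.eq_interpolate (f := (Polynomial.X ^ r : Polynomial ℝ)) hinj (by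
    rw [Polynomial.degree_X_pow, Finset.card_range]
    exact_mod_cast Nat.lt_succ_of_le hr)
  have h1 := congrArg (fun p => Polynomial.coeff p 1) h
  simp only [Lagrange.interpolate_apply, Polynomial.finsetSum_coeff, Polynomial.coeff_C_mul,
    Polynomial.eval_pow, Polynomial.eval_X, Polynomial.coeff_X_pow] at h1
  rw [Finset.sum_congr rfl fun i _ => mul_comm _ _, ← h1]
  simp [eq_comm]

/-- A random subset of `B` containing each element independently with probability `t` contains a
given `T ⊆ B` with probability `t ^ |T|`. -/
lemma sum_supersets_weight {B T : Finset ℕ} (hT : T ⊆ B) (t : ℝ) :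
    ∑ S ∈ B.powerset with T ⊆ S, t ^ S.card * (1 - t) ^ (B.card - S.card) = t ^ T.card := by
  have h := Finset.prod_add (fun _ : ℕ => t) (fun i => if i ∈ T then 0 else 1 - t) B
  have hl : ∏ i ∈ B, (t + if i ∈ T then 0 else 1 - t) = t ^ T.card := by
    have : ∀ i ∈ B, (t + if i ∈ T then 0 else 1 - t) = if i ∈ T then t else 1 := by
      intro i _; split_ifs <;> ring
    rw [Finset.prod_congr rfl this, Finset.prod_ite_mem, Finset.inter_eq_right.2 hT,
      Finset.prod_const]
  rw [← hl, h, Finset.sum_filter]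
  refine Finset.sum_congr rfl fun S hS => ?_
  have hSB := Finset.mem_powerset.1 hS
  split_ifs with hTS
  · have : ∀ i ∈ B \ S, (if i ∈ T then (0 : ℝ) else 1 - t) = 1 - t := fun i hi =>
      if_neg fun hiT => (Finset.mem_sdiff.1 hi).2 (hTS hiT)
    rw [Finset.prod_congr rfl this, Finset.prod_const, Finset.prod_const,
      Finset.card_sdiff_of_subset hSB]
  · obtain ⟨i, hiT, hiS⟩ := Finset.not_subset.1 hTS
    rw [Finset.prod_eq_zero (s := B \ S) (f := fun i => if i ∈ T then (0 : ℝ) else 1 - t)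
      (Finset.mem_sdiff.2 ⟨hT hiT, hiS⟩) (if_pos hiT), mul_zero]

lemma exists_subset_weights (k : ℕ) (hk : 1 ≤ k) :
    ∃ Λ : ℝ, 0 < Λ ∧ ∀ B : Finset ℕ, ∃ c : Finset ℕ → ℝ, ∑ S ∈ B.powerset, |c S| ≤ Λ ∧
      ∀ T ⊆ B, T.card ≤ k →
        ∑ S ∈ B.powerset with T ⊆ S, c S = if T.card = 1 then 1 else 0 := by
  obtain ⟨l, hl⟩ := exists_linearCoeff_weights k hk
  have hk0 : (0 : ℝ) < k := by exact_mod_cast hk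
  refine ⟨∑ i ∈ Finset.range (k + 1), |l i| + 1, by positivity, fun B =>
    ⟨fun S => ∑ i ∈ Finset.range (k + 1),
      l i * (((i : ℝ) / k) ^ S.card * (1 - (i : ℝ) / k) ^ (B.card - S.card)), ?_, ?_⟩⟩
  · calc _ ≤ ∑ S ∈ B.powerset, ∑ i ∈ Finset.range (k + 1),
          |l i| * (((i : ℝ) / k) ^ S.card * (1 - (i : ℝ) / k) ^ (B.card - S.card)) := by
          refine Finset.sum_le_sum fun S _ => (Finset.abs_sum_le_sum_abs _ _).trans
            (Finset.sum_le_sum fun i hi => ?_)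
          have hi' : (i : ℝ) ≤ k := by exact_mod_cast Nat.lt_succ_iff.1 (Finset.mem_range.1 hi)
          have h1 : 0 ≤ 1 - (i : ℝ) / k := sub_nonneg.2 ((div_le_one hk0).2 hi')
          rw [abs_mul, abs_of_nonneg (a := _ ^ _ * _ ^ _) (by positivity)]
      _ = ∑ i ∈ Finset.range (k + 1), |l i| := by
          rw [Finset.sum_comm]
          refine Finset.sum_congr rfl fun i _ => ?_
          rw [← Finset.mul_sum, Finset.sum_pow_mul_eq_add_pow]
          simp
      _ ≤ _ := by linarith
  · intro T hT hTk
    rw [Finset.sum_comm, ← hl _ hTk]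
    refine Finset.sum_congr rfl fun i _ => ?_
    rw [← Finset.mul_sum, sum_supersets_weight hT]

section

variable {𝕜 : Type*} [RCLike 𝕜]
variable {E : Type*} [NormedAddCommGroup E] [NormedSpace 𝕜 E]
variable {F : Type*} [NormedAddCommGroup F] [NormedSpace 𝕜 F]

/-- For a weighting `c` as in `exists_subset_weights`, the diagonal sum is a combination of the
values of the polynomial at subset sums. -/
lemma sum_diag_eq_sum_powerset {k : ℕ} (hk : 1 ≤ k)
    (A : ContinuousMultilinearMap 𝕜 (fun _ : Fin k => E) F) (x : ℕ → E) (B : Finset ℕ)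
    (c : Finset ℕ → ℝ) (hc : ∀ T ⊆ B, T.card ≤ k →
      ∑ S ∈ B.powerset with T ⊆ S, c S = if T.card = 1 then 1 else 0) :
    ∑ n ∈ B, A (fun _ => x n) =
      ∑ S ∈ B.powerset, (c S : 𝕜) • A (fun _ => ∑ n ∈ S, x n) := by
  classical
  have hmem : ∀ (S : Finset ℕ) (f : Fin k → ℕ),
      f ∈ Fintype.piFinset (fun _ : Fin k => S) ↔ Finset.univ.image f ⊆ S := by
    intro S f
    simp [Finset.image_subset_iff]
  have hpi : ∀ S ∈ B.powerset, A (fun _ => ∑ n ∈ S, x n) =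
      ∑ f ∈ Fintype.piFinset (fun _ : Fin k => B),
        if Finset.univ.image f ⊆ S then A (fun i => x (f i)) else 0 := by
    intro S hS
    rw [A.map_sum_finset (fun _ n => x n) (fun _ => S), ← Finset.sum_filter]
    refine Finset.sum_congr ?_ fun _ _ => rfl
    ext f
    rw [Finset.mem_filter, hmem, hmem]
    exact ⟨fun h => ⟨h.trans (Finset.mem_powerset.1 hS), h⟩, fun h => h.2⟩
  have h1 : ∑ S ∈ B.powerset, (c S : 𝕜) • A (fun _ => ∑ n ∈ S, x n) =
      ∑ f ∈ Fintype.piFinset (fun _ : Fin k => B),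
        (if (Finset.univ.image f).card = 1 then A (fun i => x (f i)) else 0) := by
    rw [Finset.sum_congr rfl fun S hS => by rw [hpi S hS, Finset.smul_sum], Finset.sum_comm]
    refine Finset.sum_congr rfl fun f hf => ?_
    have hcard : (Finset.univ.image f).card ≤ k := by
      simpa using Finset.card_image_le (s := Finset.univ) (f := f)
    have := congrArg (fun r : ℝ => (r : 𝕜)) (hc _ ((hmem B f).1 hf) hcard)
    simp only [smul_ite, smul_zero]
    rw [← Finset.sum_filter, ← Finset.sum_smul, ← RCLike.ofReal_sum, this]
    split_ifs <;> simp
  rw [h1, ← Finset.sum_filter]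
  have i0 : Fin k := ⟨0, hk⟩
  refine Finset.sum_bij (fun n _ _ => n) (fun n hn => ?_) (fun a _ b _ h => congrFun h i0)
    (fun f hf => ?_) fun _ _ => rfl
  · have : Finset.univ.image (fun _ : Fin k => n) = {n} :=
      Finset.image_const ⟨i0, Finset.mem_univ _⟩ n
    rw [Finset.mem_filter, hmem, this]
    simpa using hn
  · obtain ⟨hfB, hf1⟩ := Finset.mem_filter.1 hf
    obtain ⟨n, hn⟩ := Finset.card_eq_one.1 hf1
    have hfn : ∀ i, f i = n := fun i => by
      have := Finset.mem_image_of_mem f (Finset.mem_univ i)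
      rwa [hn, Finset.mem_singleton] at this
    refine ⟨n, ?_, (funext hfn).symm⟩
    have := (hmem B f).1 hfB
    rw [hn] at this
    exact this (Finset.mem_singleton_self n)

variable (𝕜) in
/-- The sum of the values of a homogeneous polynomial at finitely many vectors is controlled by
its values at the subset sums of these vectors. -/
lemma exists_norm_sum_diag_le (k : ℕ) (hk : 1 ≤ k) :
    ∃ Λ : ℝ, 0 < Λ ∧ ∀ P : E → F, IsHomogeneousPolynomial 𝕜 k P → ∀ (x : ℕ → E)
      (B : Finset ℕ) (δ : ℝ), (∀ S ⊆ B, ‖P (∑ n ∈ S, x n)‖ ≤ δ) →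
        ‖∑ n ∈ B, P (x n)‖ ≤ Λ * δ := by
  obtain ⟨Λ, hΛ, h⟩ := exists_subset_weights k hk
  refine ⟨Λ, hΛ, ?_⟩
  rintro P ⟨A, hA⟩ x B δ hδ
  obtain ⟨c, hc1, hc2⟩ := h B
  have hδ0 : 0 ≤ δ := (norm_nonneg _).trans (hδ ∅ (Finset.empty_subset _))
  simp only [hA] at hδ ⊢
  rw [sum_diag_eq_sum_powerset hk A x B c hc2]
  calc _ ≤ ∑ S ∈ B.powerset, |c S| * δ := by
        refine norm_sum_le_of_le _ fun S hS => ?_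
        rw [norm_smul, RCLike.norm_ofReal]
        exact mul_le_mul_of_nonneg_left (hδ S (Finset.mem_powerset.1 hS)) (abs_nonneg _)
    _ ≤ _ := by
        rw [← Finset.sum_mul]
        exact mul_le_mul_of_nonneg_right hc1 hδ0

lemma IsHomogeneousPolynomial.map_zero {k : ℕ} (hk : 1 ≤ k) {P : E → F}
    (hP : IsHomogeneousPolynomial 𝕜 k P) : P 0 = 0 := by
  obtain ⟨A, hA⟩ := hP
  rw [hA]
  exact A.map_coord_zero ⟨0, hk⟩ rfl

lemma IsHomogeneousPolynomial.exists_norm_le {k : ℕ} {P : E → F}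
    (hP : IsHomogeneousPolynomial 𝕜 k P) (C : ℝ) : ∃ D, ∀ v, ‖v‖ ≤ C → ‖P v‖ ≤ D := by
  obtain ⟨A, hA⟩ := hP
  refine ⟨‖A‖ * C ^ k, fun v hv => ?_⟩
  rw [hA]
  refine (A.le_opNorm _).trans (mul_le_mul_of_nonneg_left ?_ (norm_nonneg _))
  simpa using pow_le_pow_left₀ (norm_nonneg v) hv k

/-- A weakly unconditionally Cauchy series has bounded finite subset sums. -/
lemma IsWUCSeries.exists_norm_sum_le {x : ℕ → E} (hx : IsWUCSeries 𝕜 x) :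
    ∃ C, ∀ S : Finset ℕ, ‖∑ n ∈ S, x n‖ ≤ C := by
  obtain ⟨C, hC⟩ := banach_steinhaus
    (g := fun S : Finset ℕ => NormedSpace.inclusionInDoubleDual 𝕜 E (∑ n ∈ S, x n)) (fun f =>
      ⟨∑' n, ‖f (x n)‖, fun S => by
        rw [NormedSpace.dual_def, map_sum]
        exact (norm_sum_le _ _).trans ((hx f).sum_le_tsum _ fun _ _ => norm_nonneg _)⟩)
  refine ⟨C, fun S => ?_⟩
  rw [← (NormedSpace.inclusionInDoubleDualLi 𝕜 (E := E)).norm_map]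
  exact hC S

lemma summable_norm_of_norm_sum_le {a : ℕ → 𝕜} {C : ℝ}
    (h : ∀ S : Finset ℕ, ‖∑ n ∈ S, a n‖ ≤ C) : Summable fun n => ‖a n‖ := by
  have key : ∀ r : ℕ → ℝ, (∀ S : Finset ℕ, |∑ n ∈ S, r n| ≤ C) → Summable fun n => |r n| := by
    intro r hr
    refine summable_of_sum_le (c := C + C) (fun _ => abs_nonneg _) fun u => ?_
    rw [← Finset.sum_filter_add_sum_filter_not u (fun n => 0 ≤ r n)]
    have h1 : ∑ n ∈ u with 0 ≤ r n, |r n| = ∑ n ∈ u with 0 ≤ r n, r n :=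
      Finset.sum_congr rfl fun n hn => abs_of_nonneg (Finset.mem_filter.1 hn).2
    have h2 : ∑ n ∈ u with ¬ 0 ≤ r n, |r n| = -∑ n ∈ u with ¬ 0 ≤ r n, r n := by
      rw [← Finset.sum_neg_distrib]
      exact Finset.sum_congr rfl fun n hn =>
        abs_of_neg (not_le.1 (Finset.mem_filter.1 hn).2)
    rw [h1, h2]
    exact add_le_add ((le_abs_self _).trans (hr _)) ((neg_le_abs _).trans (hr _))
  have hre := key (fun n => RCLike.re (a n)) fun S => by
    rw [← map_sum]; exact (RCLike.abs_re_le_norm _).trans (h S)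
  have him := key (fun n => RCLike.im (a n)) fun S => by
    rw [← map_sum]; exact (RCLike.abs_im_le_norm _).trans (h S)
  refine Summable.of_nonneg_of_le (fun _ => norm_nonneg _) (fun n => ?_) (hre.add him)
  conv_lhs => rw [← RCLike.re_add_im (a n)]
  refine (norm_add_le _ _).trans (add_le_add (by simp) ?_)
  rw [norm_mul, RCLike.norm_ofReal]
  exact mul_le_of_le_one_right (abs_nonneg _) (by
    rw [RCLike.norm_I]; split_ifs <;> simp)

lemma isWUCSeries_of_norm_sum_le {x : ℕ → E} {C : ℝ}
    (h : ∀ S : Finset ℕ, ‖∑ n ∈ S, x n‖ ≤ C) : IsWUCSeries 𝕜 x := by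
  intro f
  refine summable_norm_of_norm_sum_le (C := ‖f‖ * C) fun S => ?_
  rw [← map_sum]
  exact (f.le_opNorm _).trans (mul_le_mul_of_nonneg_left (h S) (norm_nonneg _))

lemma IsWUCSeries.comp_injective {x : ℕ → E} (hx : IsWUCSeries 𝕜 x) {φ : ℕ → ℕ}
    (hφ : Function.Injective φ) : IsWUCSeries 𝕜 fun n => x (φ n) :=
  fun f => (hx f).comp_injective hφ

/-- Homogeneous polynomials preserve weakly unconditionally Cauchy series. -/
lemma IsHomogeneousPolynomial.isWUCSeries {k : ℕ} (hk : 1 ≤ k) {P : E → F}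
    (hP : IsHomogeneousPolynomial 𝕜 k P) {x : ℕ → E} (hx : IsWUCSeries 𝕜 x) :
    IsWUCSeries 𝕜 fun n => P (x n) := by
  obtain ⟨C, hC⟩ := hx.exists_norm_sum_le
  obtain ⟨D, hD⟩ := hP.exists_norm_le C
  obtain ⟨Λ, -, hΛ⟩ := exists_norm_sum_diag_le 𝕜 (E := E) (F := F) k hk
  exact isWUCSeries_of_norm_sum_le fun B => hΛ P hP x B D fun S _ => hD _ (hC S)

lemma IsWUCSeries.sum_disjoint {x : ℕ → E} (hx : IsWUCSeries 𝕜 x) {S : ℕ → Finset ℕ}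
    (hS : ∀ m n, m < n → Disjoint (S m) (S n)) : IsWUCSeries 𝕜 fun j => ∑ n ∈ S j, x n := by
  classical
  obtain ⟨C, hC⟩ := hx.exists_norm_sum_le
  refine isWUCSeries_of_norm_sum_le (C := C) fun B => ?_
  rw [← Finset.sum_biUnion]
  · exact hC _
  · intro i _ j _ hij
    rcases lt_or_gt_of_ne hij with h | h
    · exact hS _ _ h
    · exact (hS _ _ h).symm

/-- A homogeneous polynomial that maps weakly unconditionally Cauchy series to norm null sequences
is unconditionally converging. -/
theorem IsHomogeneousPolynomial.isUnconditionallyConverging [CompleteSpace F] {k : ℕ}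
    (hk : 1 ≤ k) {P : E → F} (hP : IsHomogeneousPolynomial 𝕜 k P)
    (h : ∀ u : ℕ → E, IsWUCSeries 𝕜 u → Tendsto (fun j => P (u j)) atTop (𝓝 0)) :
    IsUnconditionallyConverging 𝕜 P := by
  classical
  intro x hx
  have hsum : Summable fun n => P (x n) := by
    by_contra hns
    rw [summable_iff_vanishing_norm] at hns
    push Not at hns
    obtain ⟨ε, hε, hns⟩ := hns
    obtain ⟨Λ, hΛ, hle⟩ := exists_norm_sum_diag_le 𝕜 (E := E) (F := F) k hk
    set δ := ε / (2 * Λ) with hδ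
    have hδ0 : 0 < δ := by positivity
    obtain ⟨S, hS1, hS2⟩ := exists_seq_of_forall_finset_exists
      (fun S : Finset ℕ => δ ≤ ‖P (∑ n ∈ S, x n)‖) Disjoint (fun s _ => by
        obtain ⟨t, hts, ht⟩ := hns (s.sup id)
        have : ∃ S ⊆ t, δ ≤ ‖P (∑ n ∈ S, x n)‖ := by
          by_contra! hcon
          have := ht.trans (hle P hP x t δ fun S hS => (hcon S hS).le)
          have h2 : Λ * δ = ε / 2 := by rw [hδ]; field_simp
          linarith
        obtain ⟨S, hSt, hS⟩ := this
        exact ⟨S, hS, fun T hT =>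
          (hts.symm.mono_left (Finset.le_sup (f := id) hT)).mono_right hSt⟩)
    have hlim := (h _ (hx.sum_disjoint hS2)).norm
    rw [norm_zero] at hlim
    exact absurd (ge_of_tendsto' hlim hS1) (not_le.2 hδ0)
  exact fun φ hφ => ⟨_, (hsum.comp_injective hφ.injective).hasSum.tendsto_sum_nat⟩
lemma summable_ite_bool {a : ℕ → E} [CompleteSpace E] (ha : Summable fun j => ‖a j‖)
    (z : ℕ → Bool) : Summable fun j => if z j then a j else 0 :=
  Summable.of_norm_bounded ha fun j => by split_ifs <;> simp

/-- A matrix with absolutely summable rows whose row sums over every set of columns tend to `0`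
has entries tending to `0` uniformly in the column index. -/
lemma eventually_forall_norm_le_of_tendsto_subsums {a : ℕ → ℕ → 𝕜}
    (ha : ∀ m, Summable fun j => ‖a m j‖)
    (hz : ∀ z : ℕ → Bool, Tendsto (fun m => ∑' j, if z j then a m j else 0) atTop (𝓝 0))
    {ε : ℝ} (hε : 0 < ε) : ∀ᶠ m in atTop, ∀ j, ‖a m j‖ ≤ ε := by
  classical
  set g : ℕ → (ℕ → Bool) → 𝕜 := fun m z => ∑' j, if z j then a m j else 0 with hg
  have hcont : ∀ m, Continuous (g m) := fun m =>
    continuous_tsum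
      (fun j => (continuous_of_discreteTopology (f := fun b : Bool => if b then a m j else 0)).comp
        (continuous_apply j)) (ha m) fun j z => by split_ifs <;> simp
  have hupd : ∀ m j z, g m (Function.update z j true) = g m (Function.update z j false) + a m j := by
    intro m j z
    have : ∀ i, (if Function.update z j true i then a m i else 0) =
        (if Function.update z j false i then a m i else 0) + if i = j then a m j else 0 := by
      intro i
      rcases eq_or_ne i j with rfl | h
      · simp
      · simp [h]
    simp only [hg]
    rw [tsum_congr this, (summable_ite_bool (ha m) _).tsum_add
      (summable_of_hasFiniteSupport ((Set.finite_singleton j).subset fun i hi => by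
        by_contra hij
        exact hi (if_neg hij))), tsum_ite_eq]
  obtain ⟨N, z₀, hz₀⟩ := nonempty_interior_of_iUnion_of_closed
    (f := fun N : ℕ => ⋂ m ∈ Set.Ici N, {z | ‖g m z‖ ≤ ε / 2})
    (fun N => isClosed_biInter fun m _ => isClosed_le (hcont m).norm continuous_const) (by
      refine Set.eq_univ_of_forall fun z => ?_
      obtain ⟨N, hN⟩ := eventually_atTop.1
        ((hz z).norm.eventually_le_const (u := ε / 2) (by simpa using hε))
      exact Set.mem_iUnion.2 ⟨N, Set.mem_iInter₂.2 fun m hm => hN m hm⟩)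
  obtain ⟨I, U, hU, hIU⟩ := isOpen_pi_iff.1 isOpen_interior z₀ hz₀
  have hfar : ∀ m ≥ N, ∀ j ∉ I, ‖a m j‖ ≤ ε := by
    intro m hm j hj
    have hmem : ∀ b, ‖g m (Function.update z₀ j b)‖ ≤ ε / 2 := by
      intro b
      have h1 : Function.update z₀ j b ∈ ⋂ m ∈ Set.Ici N, {z | ‖g m z‖ ≤ ε / 2} := by
        refine interior_subset (hIU fun i hi => ?_)
        rw [Function.update_of_ne (fun h : i = j => hj (h ▸ hi))]
        exact (hU i hi).2
      exact Set.mem_iInter₂.1 h1 m hm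
    have := hupd m j z₀
    rw [← sub_eq_iff_eq_add'] at this
    rw [← this]
    exact (norm_sub_le _ _).trans (by linarith [hmem true, hmem false])
  have hnear : ∀ j, ∀ᶠ m in atTop, ‖a m j‖ ≤ ε := by
    intro j
    have h := (hz fun i => decide (i = j)).norm
    rw [norm_zero] at h
    filter_upwards [h.eventually_le_const hε] with m hm
    simpa using hm
  filter_upwards [eventually_ge_atTop N, (Filter.eventually_all_finset I).2 fun j _ => hnear j]
    with m hm hI j
  by_cases hj : j ∈ I
  · exact hI j hj
  · exact hfar m hm j hj

lemma tendsto_toWeakSpace_iff {ι : Type*} {l : Filter ι} {x : ι → E} {a : E} :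
    Tendsto (fun i => toWeakSpace 𝕜 E (x i)) l (𝓝 (toWeakSpace 𝕜 E a)) ↔
      ∀ f : StrongDual 𝕜 E, Tendsto (fun i => f (x i)) l (𝓝 (f a)) := by
  have h : IsInducing fun (x : WeakSpace 𝕜 E) (f : StrongDual 𝕜 E) =>
    (topDualPairing 𝕜 E).flip x f := ⟨rfl⟩
  rw [h.tendsto_nhds_iff, tendsto_pi_nhds]
  rfl

lemma isWeaklyNull_iff {x : ℕ → E} :
    IsWeaklyNull 𝕜 x ↔ ∀ f : StrongDual 𝕜 E, Tendsto (fun n => f (x n)) atTop (𝓝 0) := by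
  rw [IsWeaklyNull, ← map_zero (toWeakSpace 𝕜 E), tendsto_toWeakSpace_iff]
  simp

lemma IsWUCSeries.tendsto_dual {x : ℕ → E} (hx : IsWUCSeries 𝕜 x) (f : StrongDual 𝕜 E) :
    Tendsto (fun n => f (x n)) atTop (𝓝 0) :=
  tendsto_zero_iff_norm_tendsto_zero.2 (hx f).tendsto_atTop_zero

lemma IsWUCSeries.isWeaklyNull {x : ℕ → E} (hx : IsWUCSeries 𝕜 x) : IsWeaklyNull 𝕜 x :=
  isWeaklyNull_iff.2 hx.tendsto_dual

/-- The range of a weakly null sequence is a Rosenthal set. -/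
lemma isRosenthalSet_range {u : ℕ → E} (hu : IsWeaklyNull 𝕜 u) :
    IsRosenthalSet 𝕜 (Set.range u) := by
  intro x hx
  choose j hj using hx
  obtain ⟨g, hg⟩ := exists_increasing_or_nonincreasing_subseq (· < ·) j
  refine ⟨g, g.strictMono, fun f => ?_⟩
  simp only [← hj]
  rcases hg with hg | hg
  · exact ((isWeaklyNull_iff.1 hu f).comp
      (StrictMono.tendsto_atTop fun _ _ h => hg _ _ h)).cauchySeq
  · have hanti : Antitone fun n => j (g n) :=
      antitone_nat_of_succ_le fun n => not_lt.1 (hg n (n + 1) n.lt_succ_self)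
    exact (((continuous_of_discreteTopology (f := fun i => f (u i))).tendsto _).comp
      (tendsto_atTop_ciInf hanti (OrderBot.bddBelow _))).cauchySeq

lemma eq_of_mapClusterPt_of_tendsto {X ι : Type*} [TopologicalSpace X] [T2Space X] {l : Filter ι}
    {u : ι → X} {v w : X} (hv : MapClusterPt v l u) (hw : Tendsto u l (𝓝 w)) : v = w :=
  eq_of_nhds_neBot (hv.clusterPt.mono hw)

/-- A weakly null sequence with values in a relatively compact set is norm null. -/
lemma tendsto_zero_of_isCompact {y : ℕ → F} {K : Set F} (hK : IsCompact K) (hy : ∀ n, y n ∈ K)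
    (hy0 : IsWeaklyNull 𝕜 y) : Tendsto y atTop (𝓝 0) := by
  refine hK.tendsto_nhds_of_unique_mapClusterPt (.of_forall hy) fun v _ hv => ?_
  refine (SeparatingDual.eq_zero_iff_forall_dual_eq_zero (R := 𝕜) v).2 fun f => ?_
  exact eq_of_mapClusterPt_of_tendsto (hv.continuousAt_comp f.continuous.continuousAt)
    (isWeaklyNull_iff.1 hy0 f)

lemma IsWUCSeries.exists_bidual {u : ℕ → E} (hu : IsWUCSeries 𝕜 u) (z : ℕ → Bool) :
    ∃ Φ : StrongDual 𝕜 (StrongDual 𝕜 E), ∀ f, Φ f = ∑' j, if z j then f (u j) else 0 := by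
  refine ⟨continuousLinearMapOfTendsto (l := atTop)
    (fun N : ℕ => ∑ j ∈ Finset.range N, if z j then NormedSpace.inclusionInDoubleDual 𝕜 E (u j) else 0)
    (f := fun f => ∑' j, if z j then f (u j) else 0) (tendsto_pi_nhds.2 fun f => ?_), fun f => rfl⟩
  convert (summable_ite_bool (hu f) z).hasSum.tendsto_sum_nat using 2 with N
  rw [_root_.sum_apply]
  refine Finset.sum_congr rfl fun j _ => ?_
  split_ifs <;> simp

/-- The terms of a weakly unconditionally Cauchy series together with `0` form a Dunford-Pettis
set. -/
lemma IsWUCSeries.isDunfordPettisSet {u : ℕ → E} (hu : IsWUCSeries 𝕜 u) :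
    IsDunfordPettisSet 𝕜 (insert 0 (Set.range u)) := by
  intro f hf
  rw [isWeaklyNull_iff] at hf
  rw [ENNReal.tendsto_nhds_zero]
  intro ε hε
  obtain ⟨r, hr0, hr⟩ : ∃ r : ℝ, 0 < r ∧ ENNReal.ofReal r ≤ ε := by
    rcases eq_or_ne ε ⊤ with rfl | h
    · exact ⟨1, one_pos, le_top⟩
    · exact ⟨ε.toReal, ENNReal.toReal_pos hε.ne' h, ENNReal.ofReal_toReal_le⟩
  have hsub := eventually_forall_norm_le_of_tendsto_subsums (a := fun n j => f n (u j))
    (fun n => hu (f n)) (fun z => by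
      obtain ⟨Φ, hΦ⟩ := hu.exists_bidual z
      simpa only [hΦ] using hf Φ) hr0
  filter_upwards [hsub] with n hn
  refine iSup₂_le fun x hx => le_trans ?_ hr
  rw [← ofReal_norm]
  refine ENNReal.ofReal_le_ofReal ?_
  rcases hx with rfl | ⟨j, rfl⟩
  · simpa using hr0.le
  · exact hn j

end

lemma exists_subseq_le_norm {F : Type*} [NormedAddCommGroup F] {y : ℕ → F}
    (h : ¬ Tendsto y atTop (𝓝 0)) :
    ∃ ε > 0, ∃ φ : ℕ → ℕ, StrictMono φ ∧ ∀ n, ε ≤ ‖y (φ n)‖ := by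
  obtain ⟨s, hs, hfr⟩ := not_tendsto_iff_exists_frequently_notMem.1 h
  obtain ⟨ε, hε, hball⟩ := Metric.mem_nhds_iff.1 hs
  obtain ⟨φ, hφ, hφs⟩ := extraction_of_frequently_atTop hfr
  refine ⟨ε, hε, φ, hφ, fun n => not_lt.1 fun hlt => hφs n (hball ?_)⟩
  rwa [mem_ball_zero_iff]

section

variable {𝕜 : Type*} [RCLike 𝕜]
variable {E : Type*} [NormedAddCommGroup E] [NormedSpace 𝕜 E]
variable {F : Type*} [NormedAddCommGroup F] [NormedSpace 𝕜 F]

lemma exists_dual_ne_zero_of_notMem_of_isClosed {V : Submodule 𝕜 F} (hV : IsClosed (V : Set F))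
    {s : F} (hs : s ∉ V) : ∃ f : StrongDual 𝕜 F, f s ≠ 0 ∧ ∀ v ∈ V, f v = 0 := by
  have := hV
  obtain ⟨f, hf⟩ := SeparatingDual.exists_ne_zero (R := 𝕜) (x := V.mkQ s) (by simpa using hs)
  refine ⟨f.comp V.mkQL, hf, fun v hv => ?_⟩
  have h0 : V.mkQ v = 0 := by simpa using hv
  change f (V.mkQ v) = 0
  rw [h0, map_zero]

/-- The vectors at which a sequence of functionals is Cauchy. -/
def cauchySubmodule (g : ℕ → StrongDual 𝕜 F) : Submodule 𝕜 F where
  carrier := {v | CauchySeq fun m => g m v}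
  zero_mem' := by simpa using cauchySeq_const (0 : 𝕜)
  add_mem' {a b} ha hb := by simpa [Pi.add_def] using CauchySeq.add ha hb
  smul_mem' c a ha := by
    simpa [Function.comp_def] using (uniformContinuous_const_smul c).comp_cauchySeq ha

lemma isClosed_cauchySubmodule {g : ℕ → StrongDual 𝕜 F} (hg : ∀ m, ‖g m‖ ≤ 1) :
    IsClosed (cauchySubmodule g : Set F) := by
  refine isClosed_of_closure_subset fun v hv => Metric.cauchySeq_iff'.2 fun ε hε => ?_
  obtain ⟨w, hw, hvw⟩ := Metric.mem_closure_iff.1 hv (ε / 3) (by positivity)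
  obtain ⟨N, hN⟩ := Metric.cauchySeq_iff'.1 (show CauchySeq fun m => g m w from hw) (ε / 3)
    (by positivity)
  have hclose : ∀ m, ‖g m (v - w)‖ < ε / 3 := fun m =>
    ((g m).le_of_opNorm_le (hg m) _).trans_lt (by rwa [one_mul, ← dist_eq_norm])
  refine ⟨N, fun n hn => ?_⟩
  have h1 := hN n hn
  rw [dist_eq_norm] at h1 ⊢
  have : g n v - g N v = g n (v - w) + (g n w - g N w) - g N (v - w) := by
    simp only [map_sub]; ring
  rw [this]
  have h2 := norm_sub_le (g n (v - w) + (g n w - g N w)) (g N (v - w))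
  have h3 := norm_add_le (g n (v - w)) (g n w - g N w)
  linarith [hclose n, hclose N]

/-- A form of the Orlicz-Pettis theorem: if all subseries of a weakly unconditionally Cauchy series
converge weakly, then its terms tend to `0` in norm. -/
theorem IsWUCSeries.tendsto_zero_of_weak_subsums {y : ℕ → F} (hy : IsWUCSeries 𝕜 y)
    (hz : ∀ z : ℕ → Bool, ∃ s, ∀ f : StrongDual 𝕜 F, ∑' j, (if z j then f (y j) else 0) = f s) :
    Tendsto y atTop (𝓝 0) := by
  by_contra hnot
  obtain ⟨ε, hε, φ, hφ, hlow⟩ := exists_subseq_le_norm hnot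
  choose g hg1 hg2 using fun n => exists_dual_vector'' 𝕜 (y (φ n))
  obtain ⟨b, -, ψ, hψ, hlim⟩ :=
    (isCompact_univ_pi fun j => isCompact_closedBall (0 : 𝕜) ‖y j‖).tendsto_subseq
      (x := fun n j => g n (y j)) (fun n j _ => by
        rw [mem_closedBall_zero_iff]
        simpa using (g n).le_of_opNorm_le (hg1 n) (y j))
  set h : ℕ → StrongDual 𝕜 F := fun m => g (ψ m) with hh
  set V := cauchySubmodule h with hVdef
  have hV : IsClosed (V : Set F) := isClosed_cauchySubmodule fun m => hg1 _
  have hyV : ∀ j, y j ∈ V := fun j => ((tendsto_pi_nhds.1 hlim) j).cauchySeq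
  have hsV : ∀ (z : ℕ → Bool) s,
      (∀ f : StrongDual 𝕜 F, ∑' j, (if z j then f (y j) else 0) = f s) → s ∈ V := by
    intro z s hs
    by_contra hsV
    obtain ⟨f, hfs, hfV⟩ := exists_dual_ne_zero_of_notMem_of_isClosed hV hsV
    refine hfs ?_
    rw [← hs f]
    simp [hfV _ (hyV _)]
  have hτ : ∀ m, ∃ t ≥ m, ‖h m (y (φ (ψ t)))‖ ≤ ε / 2 := by
    intro m
    have h0 := ((hy.tendsto_dual (h m)).comp
      (hφ.tendsto_atTop.comp hψ.tendsto_atTop)).norm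
    rw [norm_zero] at h0
    obtain ⟨t, ht⟩ := ((h0.eventually_le_const (half_pos hε)).and (eventually_ge_atTop m)).exists
    exact ⟨t, ht.2, ht.1⟩
  choose τ hτm hτ using hτ
  have hτtop : Tendsto τ atTop atTop := tendsto_atTop_mono hτm tendsto_id
  have hsub := eventually_forall_norm_le_of_tendsto_subsums
    (a := fun m j => (h (τ m) - h m) (y j)) (fun m => hy _) (fun z => by
      obtain ⟨s, hs⟩ := hz z
      simp only [hs]
      obtain ⟨l, hl⟩ := cauchySeq_tendsto_of_complete
        (show CauchySeq fun m => h m s from hsV z s hs)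
      simpa using (hl.comp hτtop).sub hl) (ε := ε / 4) (by positivity)
  obtain ⟨m, hm⟩ := hsub.exists
  have h1 := hm (φ (ψ (τ m)))
  have h2 : ‖h (τ m) (y (φ (ψ (τ m))))‖ = ‖y (φ (ψ (τ m)))‖ := by
    simp only [hh, hg2, RCLike.norm_ofReal, abs_norm]
  have h3 := norm_sub_norm_le (h (τ m) (y (φ (ψ (τ m))))) (h m (y (φ (ψ (τ m)))))
  rw [sub_apply] at h1
  linarith [hlow (ψ (τ m)), hτ m]

variable (𝕜 E F) in
/-- Linear combinations of homogeneous polynomials of degrees between `1` and `d`. -/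
def polySpan (d : ℕ) : Submodule 𝕜 (E → F) :=
  Submodule.span 𝕜 {G | ∃ m, 1 ≤ m ∧ m ≤ d ∧ IsHomogeneousPolynomial 𝕜 m G}

lemma map_zero_of_mem_polySpan {d : ℕ} {G : E → F} (hG : G ∈ polySpan 𝕜 E F d) : G 0 = 0 := by
  induction hG using Submodule.span_induction with
  | mem G hG => obtain ⟨m, hm, -, hG⟩ := hG; exact hG.map_zero hm
  | zero => rfl
  | add G H _ _ hG hH => simp [hG, hH]
  | smul c G _ hG => simp [hG]

lemma isWUCSeries_of_mem_polySpan {d : ℕ} {G : E → F} (hG : G ∈ polySpan 𝕜 E F d) {x : ℕ → E}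
    (hx : IsWUCSeries 𝕜 x) : IsWUCSeries 𝕜 fun n => G (x n) := by
  induction hG using Submodule.span_induction with
  | mem G hG => obtain ⟨m, hm, -, hG⟩ := hG; exact hG.isWUCSeries hm hx
  | zero => intro f; simp
  | add G H _ _ hG hH =>
    intro f
    refine Summable.of_nonneg_of_le (fun _ => norm_nonneg _) (fun n => ?_) ((hG f).add (hH f))
    simpa using norm_add_le (f (G (x n))) (f (H (x n)))
  | smul c G _ hG =>
    intro f
    simpa using (hG f).mul_left ‖c‖

/-- The second difference `u ↦ G (s + u) - G s - G u`. -/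
def secondDiff (G : E → F) (s u : E) : F := G (s + u) - G s - G u

lemma IsHomogeneousPolynomial.secondDiff_mem {m d : ℕ} (hm : 1 ≤ m) (hmd : m ≤ d + 1) {G : E → F}
    (hG : IsHomogeneousPolynomial 𝕜 m G) (s : E) : secondDiff G s ∈ polySpan 𝕜 E F d := by
  classical
  obtain ⟨A, hA⟩ := hG
  have hne : (∅ : Finset (Fin m)) ≠ Finset.univ := fun h => by
    have := congrArg Finset.card h
    simp at this
    omega
  have hdiff : secondDiff G s = ∑ S ∈ (Finset.univ.erase ∅).erase (Finset.univ : Finset (Fin m)),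
      fun u => A (S.piecewise (fun _ => s) fun _ => u) := by
    funext u
    have hadd := A.map_add_univ (fun _ => s) fun _ => u
    rw [← Finset.add_sum_erase _ _ (Finset.mem_univ ∅), ← Finset.add_sum_erase _ _
      (Finset.mem_erase.2 ⟨hne.symm, Finset.mem_univ Finset.univ⟩)] at hadd
    rw [Finset.sum_apply, secondDiff, hA, hA, hA]
    have h0 : A (fun _ => s + u) = A ((fun _ => s) + fun _ => u) := rfl
    rw [h0, hadd]
    simp only [Finset.piecewise_empty, Finset.piecewise_univ]
    abel
  rw [hdiff]
  refine Submodule.sum_mem _ fun S hS => Submodule.subset_span ⟨Sᶜ.card, ?_, ?_, ?_⟩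
  · rw [Finset.one_le_card, Finset.nonempty_iff_ne_empty, Ne, Finset.compl_eq_empty_iff]
    exact (Finset.mem_erase.1 hS).1
  · have h1 : S.card ≠ 0 := by
      rw [Ne, Finset.card_eq_zero]
      exact (Finset.mem_erase.1 (Finset.mem_erase.1 hS).2).1
    rw [Finset.card_compl, Fintype.card_fin]
    omega
  · exact ⟨ContinuousMultilinearMap.curryFinFinset 𝕜 E F (s := S) rfl rfl A fun _ => s, fun u =>
      (ContinuousMultilinearMap.curryFinFinset_apply_const rfl rfl A s u).symm⟩

lemma secondDiff_mem_polySpan {d : ℕ} {G : E → F} (hG : G ∈ polySpan 𝕜 E F (d + 1)) (s : E) :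
    secondDiff G s ∈ polySpan 𝕜 E F d := by
  induction hG using Submodule.span_induction with
  | mem G hG => obtain ⟨m, hm, hmd, hG⟩ := hG; exact hG.secondDiff_mem hm hmd s
  | zero =>
    convert Submodule.zero_mem _ using 1
    funext u
    simp [secondDiff]
  | add G H _ _ hG hH =>
    convert Submodule.add_mem _ hG hH using 1
    funext u
    simp only [secondDiff, Pi.add_apply]
    abel
  | smul c G _ hG =>
    convert Submodule.smul_mem _ c hG using 1
    funext u
    simp [secondDiff, smul_sub]

instance instT2SpaceWeakSpace : T2Space (WeakSpace 𝕜 F) := by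
  refine (WeakBilin.isEmbedding (B := (topDualPairing 𝕜 F).flip) fun x y hxy => ?_).t2Space
  rw [← sub_eq_zero]
  refine (SeparatingDual.eq_zero_iff_forall_dual_eq_zero (R := 𝕜) _).2 fun f => ?_
  rw [map_sub, sub_eq_zero]
  exact LinearMap.congr_fun hxy f

lemma IsWeaklyCompactMap.secondDiff {X : Type*} [NormedAddCommGroup X] {G : X → F}
    (hG : IsWeaklyCompactMap 𝕜 G) (s : X) :
    IsWeaklyCompactMap 𝕜 (secondDiff G s) := by
  intro A hA
  have hsA : Bornology.IsBounded ((fun a => s + a) '' A) := by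
    obtain ⟨C, hC⟩ := hA.exists_norm_le
    refine isBounded_iff_forall_norm_le.2 ⟨‖s‖ + C, ?_⟩
    rintro _ ⟨a, ha, rfl⟩
    exact (norm_add_le _ _).trans (by linarith [hC a ha])
  have hK := ((hG _ hsA).prod (hG _ hA)).image
    (f := fun p : WeakSpace 𝕜 F × WeakSpace 𝕜 F => p.1 - toWeakSpace 𝕜 F (G s) - p.2)
    ((continuous_fst.sub continuous_const).sub continuous_snd)
  refine hK.closure_of_subset ?_
  rintro _ ⟨_, ⟨a, ha, rfl⟩, rfl⟩
  refine ⟨(toWeakSpace 𝕜 F (G (s + a)), toWeakSpace 𝕜 F (G a)), ⟨subset_closure ?_,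
    subset_closure ?_⟩, ?_⟩
  · exact ⟨_, ⟨_, ⟨a, ha, rfl⟩, rfl⟩, rfl⟩
  · exact ⟨_, ⟨a, ha, rfl⟩, rfl⟩
  · simp [UncondPoly.secondDiff]

/-- If all second differences of `G` are norm null along `u`, some subsequence of `u` has second
differences at its partial subsums that are summable. -/
lemma exists_subseq_summable_secondDiff {G : E → F} (hG0 : G 0 = 0) {u : ℕ → E}
    (h : ∀ s, Tendsto (fun j => secondDiff G s (u j)) atTop (𝓝 0)) :
    ∃ ψ : ℕ → ℕ, StrictMono ψ ∧ ∀ (z : ℕ → Bool) (m : ℕ),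
      ‖secondDiff G (∑ i ∈ Finset.range m, if z i then u (ψ i) else 0) (u (ψ m))‖ ≤
        2 * (1 / 2) ^ m := by
  classical
  have hN : ∀ p : ℕ, ∃ N, ∀ j ≥ N, ∀ S ∈ (Finset.range (p + 1)).powerset,
      ‖secondDiff G (∑ n ∈ S, u n) (u j)‖ ≤ (1 / 2) ^ p := by
    intro p
    refine eventually_atTop.1 ((Filter.eventually_all_finset _).2 fun S _ => ?_)
    have := (h (∑ n ∈ S, u n)).norm
    rw [norm_zero] at this
    exact this.eventually_le_const (by positivity)
  choose N hN using hN
  set ψ : ℕ → ℕ := fun n => Nat.rec 0 (fun _ p => max (N p) (p + 1)) n with hψdef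
  have hψs : ∀ n, ψ (n + 1) = max (N (ψ n)) (ψ n + 1) := fun n => rfl
  have hψ : StrictMono ψ := strictMono_nat_of_lt_succ fun n => by
    rw [hψs]
    exact lt_of_lt_of_le (Nat.lt_succ_self _) (le_max_right _ _)
  refine ⟨ψ, hψ, fun z m => ?_⟩
  cases m with
  | zero => simp [secondDiff, hG0]
  | succ n =>
    have hsum : ∑ i ∈ Finset.range (n + 1), (if z i then u (ψ i) else 0) =
        ∑ j ∈ ((Finset.range (n + 1)).filter fun i => z i).image ψ, u j := by
      rw [Finset.sum_image hψ.injective.injOn, Finset.sum_filter]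
    rw [hsum]
    refine (hN (ψ n) _ (by rw [hψs]; exact le_max_left _ _) _ ?_).trans ?_
    · rw [Finset.mem_powerset]
      intro j hj
      obtain ⟨i, hi, rfl⟩ := Finset.mem_image.1 hj
      have hin := Finset.mem_range.1 (Finset.mem_filter.1 hi).1
      exact Finset.mem_range.2 (Nat.lt_succ_of_le (hψ.monotone (Nat.lt_succ_iff.1 hin)))
    · calc (1 / 2 : ℝ) ^ ψ n ≤ (1 / 2) ^ n :=
            pow_le_pow_of_le_one (by norm_num) (by norm_num) hψ.le_apply
        _ = _ := by rw [pow_succ]; ring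

lemma map_sum_ite_eq_add_secondDiff {G : E → F} (hG0 : G 0 = 0) (v : ℕ → E) (z : ℕ → Bool)
    (N : ℕ) : G (∑ m ∈ Finset.range N, if z m then v m else 0) =
      (∑ m ∈ Finset.range N, if z m then G (v m) else 0) +
      ∑ m ∈ Finset.range N,
        if z m then secondDiff G (∑ i ∈ Finset.range m, if z i then v i else 0) (v m) else 0 := by
  induction N with
  | zero => simpa using hG0
  | succ N ih =>
    rw [Finset.sum_range_succ, Finset.sum_range_succ, Finset.sum_range_succ]
    split_ifs
    · rw [secondDiff, ih]
      abel
    · simpa using ih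

/-- A weakly compact polynomial without constant term maps weakly unconditionally Cauchy series to
norm null sequences. -/
theorem tendsto_zero_of_isWeaklyCompactMap [CompleteSpace F] (d : ℕ) :
    ∀ G ∈ polySpan 𝕜 E F d, IsWeaklyCompactMap 𝕜 G → ∀ u : ℕ → E, IsWUCSeries 𝕜 u →
      Tendsto (fun j => G (u j)) atTop (𝓝 0) := by
  induction d with
  | zero =>
    intro G hG _ u _
    have hempty : {G : E → F | ∃ m, 1 ≤ m ∧ m ≤ 0 ∧ IsHomogeneousPolynomial 𝕜 m G} = ∅ :=
      Set.eq_empty_of_forall_notMem fun G ⟨m, h1, h2, _⟩ => by omega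
    rw [polySpan, hempty, Submodule.span_empty, Submodule.mem_bot] at hG
    simp [hG]
  | succ d ih =>
    intro G hG hGc u' hu'
    by_contra hnot
    obtain ⟨ε, hε, φ, hφ, hlow⟩ := exists_subseq_le_norm hnot
    have hu : IsWUCSeries 𝕜 fun n => u' (φ n) := hu'.comp_injective hφ.injective
    have hG0 := map_zero_of_mem_polySpan hG
    obtain ⟨ψ, hψ, hψb⟩ := exists_subseq_summable_secondDiff hG0 fun s =>
      ih _ (secondDiff_mem_polySpan hG s) (hGc.secondDiff s) _ hu
    set v : ℕ → E := fun n => u' (φ (ψ n)) with hv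
    have hvw : IsWUCSeries 𝕜 v := hu.comp_injective hψ.injective
    have hGv := isWUCSeries_of_mem_polySpan hG hvw
    obtain ⟨C, hC⟩ := hvw.exists_norm_sum_le
    have hlim : Tendsto (fun n => G (v n)) atTop (𝓝 0) := by
      refine hGv.tendsto_zero_of_weak_subsums fun z => ?_
      have hr : Summable fun m => if z m then
          secondDiff G (∑ i ∈ Finset.range m, if z i then v i else 0) (v m) else 0 :=
        summable_ite_bool (Summable.of_nonneg_of_le (fun _ => norm_nonneg _) (hψb z)
          ((summable_geometric_of_lt_one (by norm_num) (by norm_num)).mul_left 2)) z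
      obtain ⟨r, hr⟩ := hr
      have hK := hGc _ (Metric.isBounded_closedBall (x := (0 : E)) (r := C))
      have hmem : ∀ N : ℕ,
          toWeakSpace 𝕜 F (G (∑ m ∈ Finset.range N, if z m then v m else 0)) ∈
            closure (toWeakSpace 𝕜 F '' (G '' Metric.closedBall 0 C)) := fun N =>
        subset_closure ⟨_, ⟨_, by
          rw [mem_closedBall_zero_iff, ← Finset.sum_filter]
          exact hC _, rfl⟩, rfl⟩
      obtain ⟨p, -, hp⟩ := hK.exists_mapClusterPt_of_frequently
        (l := atTop) (Eventually.of_forall hmem).frequently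
      refine ⟨(toWeakSpace 𝕜 F).symm p - r, fun f => ?_⟩
      have hcont : Continuous fun w : WeakSpace 𝕜 F => f ((toWeakSpace 𝕜 F).symm w) :=
        WeakBilin.eval_continuous (topDualPairing 𝕜 F).flip f
      have h1 := hp.continuousAt_comp hcont.continuousAt
      have h2 : Tendsto (fun N => f (G (∑ m ∈ Finset.range N, if z m then v m else 0))) atTop
          (𝓝 (∑' j, (if z j then f (G (v j)) else 0) + f r)) := by
        have h3 := (summable_ite_bool (hGv f) z).hasSum.tendsto_sum_nat.add
          ((f.continuous.tendsto r).comp hr.tendsto_sum_nat)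
        refine h3.congr fun N => ?_
        rw [map_sum_ite_eq_add_secondDiff hG0, map_add, map_sum f]
        simp only [apply_ite f, map_zero, Function.comp_apply]
      have h4 := eq_of_mapClusterPt_of_tendsto h1 h2
      rw [map_sub, h4, add_sub_cancel_right]
    have hlim' := hlim.norm
    rw [norm_zero] at hlim'
    exact absurd (ge_of_tendsto' hlim' fun n => hlow (ψ n)) (not_le.2 hε)

end

end UncondPoly

theorem mainTheorem7 {𝕜 : Type*} [RCLike 𝕜]
    {E : Type*} [NormedAddCommGroup E] [NormedSpace 𝕜 E] [CompleteSpace E]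
    {F : Type*} [NormedAddCommGroup F] [NormedSpace 𝕜 F] [CompleteSpace F]
    (k : ℕ) (hk : 1 ≤ k) (P : E → F) (hP : UncondPoly.IsHomogeneousPolynomial 𝕜 k P) :
    (UncondPoly.IsCompletelyContinuousAtZero 𝕜 P →
      UncondPoly.IsUnconditionallyConverging 𝕜 P) ∧
    (UncondPoly.MapsRosenthalToRelativelyCompact 𝕜 P →
      UncondPoly.IsUnconditionallyConverging 𝕜 P) ∧
    (UncondPoly.IsWeaklyContinuousOnDunfordPettisSets 𝕜 P →
      UncondPoly.IsUnconditionallyConverging 𝕜 P) ∧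
    (UncondPoly.IsWeaklyCompactMap 𝕜 P →
      UncondPoly.IsUnconditionallyConverging 𝕜 P) := by
  refine ⟨fun h => ?_, fun h => ?_, fun h => ?_, fun h => ?_⟩ <;>
    refine hP.isUnconditionallyConverging hk fun u hu => ?_
  · exact h u hu.isWeaklyNull
  · exact UncondPoly.tendsto_zero_of_isCompact
      (h _ (UncondPoly.isRosenthalSet_range hu.isWeaklyNull))
      (fun n => subset_closure ⟨_, ⟨n, rfl⟩, rfl⟩) (hP.isWUCSeries hk hu).isWeaklyNull
  · have hc := h _ hu.isDunfordPettisSet (toWeakSpace 𝕜 E 0) ⟨0, Set.mem_insert _ _, rfl⟩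
    have hlim := hc.tendsto.comp (tendsto_nhdsWithin_iff.2
      ⟨UncondPoly.tendsto_toWeakSpace_iff.2 fun f => by simpa using hu.tendsto_dual f,
        .of_forall fun n => ⟨u n, Set.mem_insert_of_mem _ ⟨n, rfl⟩, rfl⟩⟩)
    simpa [Function.comp_def, hP.map_zero hk] using hlim
  · exact UncondPoly.tendsto_zero_of_isWeaklyCompactMap k P
      (Submodule.subset_span ⟨k, hk, le_rfl, hP⟩) h u hu
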